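/- For $n\ge 1$ equip $\mathbb R^{n\times n}$ with the inner product $\langle X,Y\rangle=\operatorname{tr}(X^TY)$, let $$P(n)=\mathrm{COR}(n)=\operatorname{conv}\{bb^T \mid b\in\{0,1\}^n\}$$ be the correlation polytope, and let $$Q(n)=\{x\in\mathbb R^{n\times n} \mid \langle 2\operatorname{diag}(a)-aa^T,\,x\rangle\le 1 \text{ for all } a\in\{0,1\}^n\}.$$ Let $S_{P(n),Q(n)}$ be the slack matrix of the pair $P(n)\subseteq Q(n)$: its rows are indexed by the facet inequalities $\langle h,x\rangle\le 1$ of $Q(n)$, its columns by the vertices $p$ of $P(n)$, and its $(h,p)$ entry is $1-\langle h,p\rangle$. For a nonnegative matrix $S$, let $\operatorname{rank}_+(S)$ be the least $r$ such that $S=A^TB$ for some entrywise nonnegative matrices $A$, $B$ with $r$ rows, and let $\|M\|_\infty=\max_{i,j}|M_{ij}|$. Let $0<\eta<1/2$. Then there are a constant $c>0$ and an integer $N$, depending only on $\eta$, such that for every $n\ge N$ and every entrywise nonnegative matrix $S'$ of the same size as $S_{P(n),Q(n)}$ with $\|S_{P(n),Q(n)}-S'\|_\infty\le\eta$, $$\operatorname{rank}_+(S')\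 \ge\ 2^{cn}.$$ -/

import Mathlib

open scoped Matrix

noncomputable section

namespace CorrelationSlack

/-- The set `{0,1}^n`, as a set of real vectors. -/
def zeroOneVectors (n : ℕ) : Set (Fin n → ℝ) :=
  {b | ∀ i, b i = 0 ∨ b i = 1}

/-- The standard (trace) inner product on `ℝ^{n × n}`. -/
def traceInner {n : ℕ} (A B : Matrix (Fin n) (Fin n) ℝ) : ℝ :=
  (Aᵀ * B).trace

/-- The correlation polytope `COR(n) = conv {b bᵀ | b ∈ {0,1}^n}`. -/
def correlationPolytope (n : ℕ) : Set (Matrix (Fin n) (Fin n) ℝ) :=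
  convexHull ℝ ((fun b : Fin n → ℝ => Matrix.vecMulVec b b) '' zeroOneVectors n)

/-- The polyhedron `{x ∈ ℝ^{n × n} | ⟨2 diag(a) - a aᵀ, x⟩ ≤ 1 for all a ∈ {0,1}^n}`. -/
def cliquePolyhedron (n : ℕ) : Set (Matrix (Fin n) (Fin n) ℝ) :=
  {x | ∀ a ∈ zeroOneVectors n,
    traceInner ((2 : ℝ) • Matrix.diagonal a - Matrix.vecMulVec a a) x ≤ 1}

/-- `⟨h, x⟩ ≤ 1` is a facet inequality of `Q`: it is valid on `Q`, and the face of `Q` where it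
holds with equality is nonempty and of dimension `dim Q - 1`. -/
def IsFacetNormal {n : ℕ} (Q : Set (Matrix (Fin n) (Fin n) ℝ))
    (h : Matrix (Fin n) (Fin n) ℝ) : Prop :=
  (∀ x ∈ Q, traceInner h x ≤ 1) ∧
  {x ∈ Q | traceInner h x = 1}.Nonempty ∧
  Module.finrank ℝ (vectorSpan ℝ {x ∈ Q | traceInner h x = 1}) + 1 =
    Module.finrank ℝ (vectorSpan ℝ Q)

/-- The slack matrix `S_{P,Q}` of a pair `P ⊆ Q`: the rows are indexed by the facet inequalities
`⟨h, x⟩ ≤ 1` of `Q`, the columns by the vertices `p` of `P`, and the entry is `1 - ⟨h, p⟩`. -/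
def slackMatrix {n : ℕ} (P Q : Set (Matrix (Fin n) (Fin n) ℝ)) :
    Matrix {h : Matrix (Fin n) (Fin n) ℝ // IsFacetNormal Q h} (P.extremePoints ℝ) ℝ :=
  fun h p => 1 - traceInner h.1 p.1

/-- `S = Aᵀ B` for entrywise nonnegative matrices `A`, `B` with `r` rows
(an `ℝ^r_+`-factorization of `S`). -/
def HasNonnegFactorization {ι κ : Type*} (S : Matrix ι κ ℝ) (r : ℕ) : Prop :=
  ∃ (A : Matrix (Fin r) ι ℝ) (B : Matrix (Fin r) κ ℝ),
    (∀ k i, 0 ≤ A k i) ∧ (∀ k j, 0 ≤ B k j) ∧ S = Aᵀ * B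

/-- The nonnegative rank of `S`: the least `r` for which `S` has an `ℝ^r_+`-factorization
(`⊤` if there is none, which does not happen for a nonnegative matrix of finite size). -/
def nonnegRank {ι κ : Type*} (S : Matrix ι κ ℝ) : ℕ∞ :=
  ⨅ (r : ℕ) (_ : HasNonnegFactorization S r), (r : ℕ∞)

end CorrelationSlack

end

/-!
The inequality of every nonzero `a ∈ {0,1}^n` is a facet of `Q(n)`, and every `b bᵀ` is a vertex of
`P(n)`; the corresponding slack is `(1 - ⟨a, b⟩)²` (`exists_slackMatrix_eq`). So a matrix `S'` that is
`η`-close to the slack matrix is at least `1 - η` on pairs of disjoint sets and at most `η` on pairs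
with exactly one common element, and `η < 1 - η`.

Nonnegative matrices of rank one cannot distinguish the two kinds of pairs well. Take a nonnegative
rank-one matrix `u a * v b` with entries in `[0, 1]`, and choose a random pair of disjoint sets by
choosing `T` at random and then `a ⊆ T`, `b ⊆ Tᶜ` uniformly; given `T`, the average is a product
`α(T) β(Tᶜ)` of averages of `u` and `v`. To pass to a pair with intersection `{i}`, force `i` into
both sets. This changes `α` and `β` only a little unless `i` is influential for `u` or `v`, and the
level-one inequality (`sum_sq_subsetAvg_erase_sub_le`) says that there are at most `2 D / ε²`
influential elements unless one of the averages is below `exp (-D)`. Hence the average over disjoint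
pairs is at most `(1 + ε) / (1 - ε)²` times the average over pairs with one common element, plus
a small multiple of itself and an error of order `exp (-D)` (`sum_disjointAvg_le`).

Summing over the `r` rank-one terms of a factorization of `S'`, with `D` a small multiple of `n`, the
errors must make up for the gap between `η` and `1 - η`, which forces `r n² ≥ g exp (δ n)` for
positive constants `g` and `δ` (`exp_le_mul_of_abs_sub_le`).
-/

namespace CorrelationSlack

open Finset

/-! ### Averages over the subsets of a finite set and the level-one inequality -/

section SubsetAverage

variable {ι : Type*}

/-- The average of `u` over the subsets of `T`. -/
noncomputable def subsetAvg (u : Finset ι → ℝ) (T : Finset ι) : ℝ :=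
  (∑ a ∈ T.powerset, u a) / 2 ^ #T

lemma subsetAvg_nonneg {u : Finset ι → ℝ} (hu : ∀ a, 0 ≤ u a) (T : Finset ι) :
    0 ≤ subsetAvg u T :=
  div_nonneg (sum_nonneg fun a _ => hu a) (by positivity)

lemma subsetAvg_mono {u v : Finset ι → ℝ} {T : Finset ι} (h : ∀ a ⊆ T, u a ≤ v a) :
    subsetAvg u T ≤ subsetAvg v T :=
  div_le_div_of_nonneg_right (sum_le_sum fun a ha => h a (mem_powerset.1 ha)) (by positivity)

lemma subsetAvg_const (c : ℝ) (T : Finset ι) : subsetAvg (fun _ => c) T = c := by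
  simp [subsetAvg, card_powerset]

lemma subsetAvg_le_one {u : Finset ι → ℝ} (hu : ∀ a, u a ≤ 1) (T : Finset ι) :
    subsetAvg u T ≤ 1 :=
  (subsetAvg_mono fun a _ => hu a).trans_eq (subsetAvg_const 1 T)

lemma subsetAvg_const_mul (c : ℝ) (u : Finset ι → ℝ) (T : Finset ι) :
    subsetAvg (fun a => c * u a) T = c * subsetAvg u T := by
  simp [subsetAvg, ← mul_sum, mul_div_assoc]

lemma subsetAvg_add (u v : Finset ι → ℝ) (T : Finset ι) :
    subsetAvg (fun a => u a + v a) T = subsetAvg u T + subsetAvg v T := by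
  simp [subsetAvg, sum_add_distrib, add_div]

lemma subsetAvg_sum {κ : Type*} (s : Finset κ) (u : κ → Finset ι → ℝ) (T : Finset ι) :
    subsetAvg (fun a => ∑ k ∈ s, u k a) T = ∑ k ∈ s, subsetAvg (u k) T := by
  simp only [subsetAvg, sum_div]
  rw [sum_comm]

variable [DecidableEq ι]

lemma subsetAvg_insert (u : Finset ι → ℝ) {T : Finset ι} {i : ι} (hi : i ∉ T) :
    subsetAvg u (insert i T) =
      (subsetAvg u T + subsetAvg (fun a => u (insert i a)) T) / 2 := by
  simp only [subsetAvg, sum_powerset_insert hi, card_insert_of_notMem hi, pow_succ]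
  field_simp

/-- The difference between the two averages is the Fourier coefficient of `u` at `{i}` on the cube
of subsets of `T`. -/
lemma subsetAvg_mul_sign (u : Finset ι → ℝ) {T : Finset ι} {i : ι} (hi : i ∈ T) :
    subsetAvg (fun a => u a * (if i ∈ a then -1 else 1)) T =
      subsetAvg u (T.erase i) - subsetAvg u T := by
  obtain ⟨S, hS, rfl⟩ : ∃ S, i ∉ S ∧ T = insert i S :=
    ⟨T.erase i, notMem_erase i T, (insert_erase hi).symm⟩
  rw [subsetAvg_insert _ hS, subsetAvg_insert _ hS, erase_insert hS]
  have h1 : subsetAvg (fun a => u a * (if i ∈ a then -1 else 1)) S = subsetAvg u S := by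
    unfold subsetAvg
    congr 1
    refine sum_congr rfl fun a ha => ?_
    have : i ∉ a := fun h => hS (mem_powerset.1 ha h)
    simp [this]
  have h2 : subsetAvg (fun a => u (insert i a) * (if i ∈ insert i a then -1 else 1)) S =
      -subsetAvg (fun a => u (insert i a)) S := by
    simp [subsetAvg, neg_div]
  rw [h1, h2]
  ring

lemma subsetAvg_exp_sum_sign (c : ι → ℝ) (T : Finset ι) :
    subsetAvg (fun a => Real.exp (∑ i ∈ T, c i * (if i ∈ a then -1 else 1))) T =
      ∏ i ∈ T, Real.cosh (c i) := by
  have h : ∀ i ∈ T, Real.cosh (c i) = (Real.exp (-c i) + Real.exp (c i)) / 2 := fun i _ => by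
    rw [Real.cosh_eq, add_comm]
  rw [prod_congr rfl h, prod_div_distrib, prod_add, prod_const]
  unfold subsetAvg
  congr 1
  refine sum_congr rfl fun a ha => ?_
  rw [← Real.exp_sum, ← Real.exp_sum, ← Real.exp_add]
  beta_reduce
  rw [← sum_sdiff (mem_powerset.1 ha), add_comm]
  congr 2
  · exact sum_congr rfl fun i hi => by simp [hi]
  · exact sum_congr rfl fun i hi => by simp [(mem_sdiff.1 hi).2]

/-- The level-one inequality: a `[0, 1]`-valued function of mean `α` on a cube has level-one Fourier
weight at most `2 α² log (1 / α)`. With `L` the linear form whose coefficients are the Fourier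
coefficients divided by `α`, Jensen's inequality for the density `u / α` bounds
`α exp (E[u L] / α)` by `E[exp L]`, which is a product of hyperbolic cosines. -/
lemma sum_sq_subsetAvg_erase_sub_le {u : Finset ι → ℝ} (hu0 : ∀ a, 0 ≤ u a) (hu1 : ∀ a, u a ≤ 1)
    (T : Finset ι) (hα : 0 < subsetAvg u T) :
    ∑ i ∈ T, (subsetAvg u (T.erase i) - subsetAvg u T) ^ 2 ≤
      2 * subsetAvg u T ^ 2 * Real.log (1 / subsetAvg u T) := by
  set α := subsetAvg u T with hαdef
  set d : ι → ℝ := fun i => subsetAvg u (T.erase i) - α with hd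
  set X := ∑ i ∈ T, d i ^ 2 with hX
  set L : Finset ι → ℝ := fun a => ∑ i ∈ T, d i / α * (if i ∈ a then -1 else 1) with hL
  have huL : subsetAvg (fun a => u a * L a) T = X / α := by
    have : (fun a => u a * L a) =
        fun a => ∑ i ∈ T, d i / α * (u a * (if i ∈ a then -1 else 1)) := by
      funext a
      rw [hL, mul_sum]
      exact sum_congr rfl fun i _ => by ring
    rw [this, subsetAvg_sum, hX, sum_div]
    refine sum_congr rfl fun i hi => ?_
    rw [subsetAvg_const_mul, subsetAvg_mul_sign u hi]
    simp only [hd]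
    ring
  have hupper : subsetAvg (fun a => Real.exp (L a)) T ≤ Real.exp (X / (2 * α ^ 2)) := by
    rw [hL, subsetAvg_exp_sum_sign]
    calc ∏ i ∈ T, Real.cosh (d i / α) ≤ ∏ i ∈ T, Real.exp ((d i / α) ^ 2 / 2) :=
          prod_le_prod (fun i _ => (Real.cosh_pos _).le) fun i _ => Real.cosh_le_exp_half_sq _
      _ = Real.exp (X / (2 * α ^ 2)) := by
          rw [← Real.exp_sum, hX, sum_div]
          congr 1
          exact sum_congr rfl fun i _ => by field_simp
  have hlower : α * Real.exp (X / α ^ 2) ≤ subsetAvg (fun a => Real.exp (L a)) T := by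
    set m := X / α ^ 2 with hm
    have hpt : subsetAvg (fun a => Real.exp m * (1 - m) * u a + Real.exp m * (u a * L a)) T ≤
        subsetAvg (fun a => Real.exp (L a)) T := by
      refine subsetAvg_mono fun a _ => ?_
      -- the tangent line of `exp` at `m`
      have h1 : Real.exp m * (L a - m + 1) ≤ Real.exp (L a) := by
        calc Real.exp m * (L a - m + 1) ≤ Real.exp m * Real.exp (L a - m) :=
              mul_le_mul_of_nonneg_left (Real.add_one_le_exp _) (Real.exp_pos _).le
          _ = Real.exp (L a) := by rw [← Real.exp_add]; ring_nf
      calc _ = u a * (Real.exp m * (L a - m + 1)) := by ring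
        _ ≤ u a * Real.exp (L a) := mul_le_mul_of_nonneg_left h1 (hu0 a)
        _ ≤ Real.exp (L a) := mul_le_of_le_one_left (Real.exp_pos _).le (hu1 a)
    rw [subsetAvg_add, subsetAvg_const_mul, subsetAvg_const_mul, huL, ← hαdef] at hpt
    refine le_trans (le_of_eq ?_) hpt
    rw [hm]
    field_simp
    ring
  have hlog := Real.log_le_log (by positivity) (hlower.trans hupper)
  rw [Real.log_mul hα.ne' (Real.exp_pos _).ne', Real.log_exp, Real.log_exp] at hlog
  rw [one_div, Real.log_inv]
  have h2 : X / α ^ 2 = 2 * (X / (2 * α ^ 2)) := by field_simp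
  have h3 : X / α ^ 2 ≤ 2 * -Real.log α := by linarith
  rw [div_le_iff₀ (by positivity)] at h3
  linarith

/-- `i` influences `u` on the subsets of `T`: forbidding `i` changes the average by more than the
fraction `ε`. -/
def IsInfluential (ε : ℝ) (u : Finset ι → ℝ) (T : Finset ι) (i : ι) : Prop :=
  ε * subsetAvg u T < |subsetAvg u (T.erase i) - subsetAvg u T|

open Classical in
lemma card_filter_isInfluential_le {u : Finset ι → ℝ} (hu0 : ∀ a, 0 ≤ u a) (hu1 : ∀ a, u a ≤ 1)
    {ε D : ℝ} (hε : 0 < ε) (T : Finset ι) (hα : Real.exp (-D) ≤ subsetAvg u T) :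
    (#{i ∈ T | IsInfluential ε u T i} : ℝ) ≤ 2 * D / ε ^ 2 := by
  have hpos : 0 < subsetAvg u T := (Real.exp_pos _).trans_le hα
  have hlog : Real.log (1 / subsetAvg u T) ≤ D := by
    rw [one_div, Real.log_inv, neg_le]
    exact (Real.le_log_iff_exp_le hpos).2 hα
  have h1 := sum_sq_subsetAvg_erase_sub_le hu0 hu1 T hpos
  have h2 : (#{i ∈ T | IsInfluential ε u T i} : ℝ) * (ε * subsetAvg u T) ^ 2 ≤
      ∑ i ∈ T, (subsetAvg u (T.erase i) - subsetAvg u T) ^ 2 := by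
    rw [← nsmul_eq_mul]
    refine (card_nsmul_le_sum _ _ _ fun i hi => ?_).trans
      (sum_le_sum_of_subset_of_nonneg (filter_subset _ T) fun i _ _ => sq_nonneg _)
    rw [← sq_abs (subsetAvg u (T.erase i) - subsetAvg u T)]
    exact pow_le_pow_left₀ (by positivity) (mem_filter.1 hi).2.le 2
  have h3 : 2 * subsetAvg u T ^ 2 * Real.log (1 / subsetAvg u T) ≤ 2 * subsetAvg u T ^ 2 * D :=
    mul_le_mul_of_nonneg_left hlog (by positivity)
  rw [le_div_iff₀ (by positivity)]
  have h4 : 0 < subsetAvg u T ^ 2 := by positivity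
  refine le_of_mul_le_mul_right ?_ h4
  nlinarith

open Classical in
/-- The influential elements of `T` contribute little to any quantity `w ≤ subsetAvg u T`: they are
few unless `subsetAvg u T` itself is tiny. -/
lemma sum_ite_isInfluential_le {u : Finset ι → ℝ} (hu0 : ∀ a, 0 ≤ u a) (hu1 : ∀ a, u a ≤ 1)
    {ε D w : ℝ} (hε : 0 < ε) (hD : 0 ≤ D) (T : Finset ι) (hw0 : 0 ≤ w) (hw : w ≤ subsetAvg u T) :
    ∑ i ∈ T, (if IsInfluential ε u T i then w else 0) ≤
      2 * D / ε ^ 2 * w + #T * Real.exp (-D) := by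
  rw [← sum_filter, sum_const, nsmul_eq_mul]
  rcases le_or_gt (Real.exp (-D)) (subsetAvg u T) with h | h
  · have h1 := mul_le_mul_of_nonneg_right (card_filter_isInfluential_le hu0 hu1 hε T h) hw0
    have h2 : 0 ≤ #T * Real.exp (-D) := by positivity
    exact h1.trans (le_add_of_nonneg_right h2)
  · have h1 : (#{i ∈ T | IsInfluential ε u T i} : ℝ) * w ≤ #T * Real.exp (-D) := by
      gcongr
      · exact filter_subset _ T
      · exact hw.trans h.le
    have h2 : 0 ≤ 2 * D / ε ^ 2 * w := by positivity
    exact h1.trans (le_add_of_nonneg_left h2)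

end SubsetAverage

/-! ### Disjoint pairs against pairs with one common element -/

section Rectangle

variable {ι : Type*} [Fintype ι] [DecidableEq ι]

lemma sum_sum_compl_insert (g : Finset ι → ι → ℝ) :
    ∑ T : Finset ι, ∑ i ∈ Tᶜ, g (insert i T) i = ∑ T : Finset ι, ∑ i ∈ T, g T i := by
  rw [sum_sigma', sum_sigma']
  refine sum_bij' (fun x _ => ⟨insert x.2 x.1, x.2⟩) (fun x _ => ⟨x.1.erase x.2, x.2⟩)
    ?_ ?_ ?_ ?_ ?_
  · simp
  · simp
  · rintro ⟨T, i⟩ h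
    simp at h
    simp [erase_insert h]
  · rintro ⟨T, i⟩ h
    simp at h
    simp [insert_erase h]
  · simp

/-- The average of `u a * v b` over `a ⊆ T` and `b ⊆ Tᶜ`. -/
noncomputable def disjointAvg (u v : Finset ι → ℝ) (T : Finset ι) : ℝ :=
  subsetAvg u T * subsetAvg v Tᶜ

/-- The average of `u a * v b` over the pairs with `a ∩ b = {i}`, `a \ {i} ⊆ T` and
`b \ {i} ⊆ Tᶜ`. -/
noncomputable def crossAvg (u v : Finset ι → ℝ) (T : Finset ι) (i : ι) : ℝ :=
  subsetAvg (fun a => u (insert i a)) T * subsetAvg (fun b => v (insert i b)) (Tᶜ.erase i)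

open Classical in
/-- When `i` influences `u` but not `v`, the bound is in terms of `insert i T`, because the
influential elements for `u` are counted among those of the set that contains them. -/
lemma disjointAvg_le_crossAvg_add {u v : Finset ι → ℝ} (hu : ∀ a, 0 ≤ u a) (hv : ∀ b, 0 ≤ v b)
    {ε : ℝ} (hε : 0 < ε) (hε2 : ε ≤ 1 / 2) {T : Finset ι} {i : ι} (hi : i ∈ Tᶜ) :
    disjointAvg u v T ≤ (1 + ε) / (1 - ε) ^ 2 * crossAvg u v T i +
      (if IsInfluential ε v Tᶜ i then disjointAvg u v T else 0) +
      4 * (if IsInfluential ε u (insert i T) i then disjointAvg u v (insert i T) else 0) := by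
  have hiT : i ∉ T := mem_compl.1 hi
  have hα : 0 ≤ subsetAvg u T := subsetAvg_nonneg hu _
  have hα' : 0 ≤ subsetAvg (fun a => u (insert i a)) T := subsetAvg_nonneg (fun _ => hu _) _
  have hβ : 0 ≤ subsetAvg v Tᶜ := subsetAvg_nonneg hv _
  have hβ' : 0 ≤ subsetAvg (fun b => v (insert i b)) (Tᶜ.erase i) :=
    subsetAvg_nonneg (fun _ => hv _) _
  have hγ : 0 ≤ subsetAvg v (Tᶜ.erase i) := subsetAvg_nonneg hv _
  have hins := subsetAvg_insert u hiT
  have hins' : subsetAvg v Tᶜ = (subsetAvg v (Tᶜ.erase i) +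
      subsetAvg (fun b => v (insert i b)) (Tᶜ.erase i)) / 2 := by
    rw [← subsetAvg_insert v (notMem_erase i _), insert_erase hi]
  have hcompl : (insert i T)ᶜ = Tᶜ.erase i := by rw [compl_insert]
  have hcross : 0 ≤ crossAvg u v T i := mul_nonneg hα' hβ'
  have hC : 0 ≤ (1 + ε) / (1 - ε) ^ 2 := by positivity
  by_cases h1 : IsInfluential ε v Tᶜ i
  · rw [if_pos h1]
    have : 0 ≤ 4 * (if IsInfluential ε u (insert i T) i then disjointAvg u v (insert i T)
        else 0) := by
      split_ifs
      · exact mul_nonneg (by norm_num)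
          (mul_nonneg (subsetAvg_nonneg hu _) (subsetAvg_nonneg hv _))
      · simp
    have := mul_nonneg hC hcross
    linarith
  have g1 := abs_le.1 (not_lt.1 h1)
  rw [if_neg h1, add_zero]
  by_cases h2 : IsInfluential ε u (insert i T) i
  · rw [if_pos h2]
    have := mul_nonneg hC hcross
    -- losing the influential element costs a factor of at most two in each average
    have e1 : subsetAvg u T ≤ 2 * subsetAvg u (insert i T) := by linarith
    have e2 : subsetAvg v Tᶜ ≤ 2 * subsetAvg v (Tᶜ.erase i) := by nlinarith
    have : disjointAvg u v T ≤ 4 * disjointAvg u v (insert i T) := by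
      unfold disjointAvg
      rw [hcompl]
      nlinarith [mul_le_mul e1 e2 hβ (by linarith)]
    linarith
  · rw [if_neg h2, mul_zero, add_zero]
    have g2 := abs_le.1 (not_lt.1 h2)
    rw [erase_insert hiT] at g2
    have e1 : (1 - ε) * subsetAvg u T ≤ (1 + ε) * subsetAvg (fun a => u (insert i a)) T := by
      nlinarith
    have e2 : (1 - ε) * subsetAvg v Tᶜ ≤ subsetAvg (fun b => v (insert i b)) (Tᶜ.erase i) := by
      nlinarith
    unfold disjointAvg crossAvg
    have h0 : 0 < 1 - ε := by linarith
    rw [div_mul_eq_mul_div, le_div_iff₀ (by positivity)]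
    have := mul_le_mul e1 e2 (by positivity) (by positivity)
    nlinarith

/-- For a nonnegative matrix of rank one with entries in `[0, 1]`, the average over disjoint pairs
exceeds the average over pairs with one common element by at most a factor close to one, up to an
error term for the pairs `(T, i)` with `i` influential and one for the `T` with a tiny average. -/
lemma sum_disjointAvg_le {u v : Finset ι → ℝ} (hu0 : ∀ a, 0 ≤ u a) (hu1 : ∀ a, u a ≤ 1)
    (hv0 : ∀ b, 0 ≤ v b) (hv1 : ∀ b, v b ≤ 1) {ε D : ℝ} (hε : 0 < ε) (hε2 : ε ≤ 1 / 2)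
    (hD : 0 ≤ D) :
    ∑ T : Finset ι, ∑ _i ∈ Tᶜ, disjointAvg u v T ≤
      (1 + ε) / (1 - ε) ^ 2 * ∑ T : Finset ι, ∑ i ∈ Tᶜ, crossAvg u v T i +
      10 * D / ε ^ 2 * ∑ T : Finset ι, disjointAvg u v T +
      5 * (2 ^ Fintype.card ι * (Fintype.card ι * Real.exp (-D))) := by
  classical
  have hd0 : ∀ T, 0 ≤ disjointAvg u v T := fun T =>
    mul_nonneg (subsetAvg_nonneg hu0 _) (subsetAvg_nonneg hv0 _)
  have hdu : ∀ T, disjointAvg u v T ≤ subsetAvg u T := fun T =>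
    mul_le_of_le_one_right (subsetAvg_nonneg hu0 _) (subsetAvg_le_one hv1 _)
  have hdv : ∀ T, disjointAvg u v T ≤ subsetAvg v Tᶜ := fun T =>
    mul_le_of_le_one_left (subsetAvg_nonneg hv0 _) (subsetAvg_le_one hu1 _)
  have h1 := sum_le_sum fun (T : Finset ι) (_ : T ∈ univ) =>
    sum_le_sum fun i (hi : i ∈ Tᶜ) => disjointAvg_le_crossAvg_add hu0 hv0 hε hε2 hi
  simp only [sum_add_distrib, ← mul_sum] at h1
  rw [sum_sum_compl_insert (fun T i =>
    if IsInfluential ε u T i then disjointAvg u v T else 0)] at h1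
  have hnum : ∑ _T : Finset ι, (Fintype.card ι * Real.exp (-D)) =
      2 ^ Fintype.card ι * (Fintype.card ι * Real.exp (-D)) := by
    simp
  have h2 : ∑ T : Finset ι, ∑ i ∈ Tᶜ, (if IsInfluential ε v Tᶜ i then disjointAvg u v T else 0) ≤
      2 * D / ε ^ 2 * ∑ T : Finset ι, disjointAvg u v T +
        2 ^ Fintype.card ι * (Fintype.card ι * Real.exp (-D)) := by
    rw [← hnum, mul_sum, ← sum_add_distrib]
    refine sum_le_sum fun T _ =>
      (sum_ite_isInfluential_le hv0 hv1 hε hD Tᶜ (hd0 T) (hdv T)).trans ?_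
    gcongr
    exact card_le_univ _
  have h3 : ∑ T : Finset ι, ∑ i ∈ T, (if IsInfluential ε u T i then disjointAvg u v T else 0) ≤
      2 * D / ε ^ 2 * ∑ T : Finset ι, disjointAvg u v T +
        2 ^ Fintype.card ι * (Fintype.card ι * Real.exp (-D)) := by
    rw [← hnum, mul_sum, ← sum_add_distrib]
    refine sum_le_sum fun T _ =>
      (sum_ite_isInfluential_le hu0 hu1 hε hD T (hd0 T) (hdu T)).trans ?_
    gcongr
    exact card_le_univ _
  have h4 : 10 * D / ε ^ 2 * ∑ T : Finset ι, disjointAvg u v T =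
      5 * (2 * D / ε ^ 2 * ∑ T : Finset ι, disjointAvg u v T) := by ring
  linarith

/-- The homogeneous form of `sum_disjointAvg_le`. -/
lemma sum_disjointAvg_le_of_mul_le {u v : Finset ι → ℝ} (hu : ∀ a, 0 ≤ u a) (hv : ∀ b, 0 ≤ v b)
    {B : ℝ} (hB : ∀ a b, u a * v b ≤ B) {ε D : ℝ} (hε : 0 < ε) (hε2 : ε ≤ 1 / 2) (hD : 0 ≤ D) :
    ∑ T : Finset ι, ∑ _i ∈ Tᶜ, disjointAvg u v T ≤
      (1 + ε) / (1 - ε) ^ 2 * ∑ T : Finset ι, ∑ i ∈ Tᶜ, crossAvg u v T i +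
      10 * D / ε ^ 2 * ∑ T : Finset ι, disjointAvg u v T +
      5 * (2 ^ Fintype.card ι * (Fintype.card ι * Real.exp (-D))) * B := by
  obtain ⟨a₀, ha₀⟩ := Finite.exists_max u
  obtain ⟨b₀, hb₀⟩ := Finite.exists_max v
  rcases (mul_nonneg (hu a₀) (hv b₀)).eq_or_lt with h0 | hpos
  · -- one of the two factors vanishes identically
    have hz : (∀ a, u a = 0) ∨ ∀ b, v b = 0 := by
      rcases mul_eq_zero.1 h0.symm with h | h
      · exact Or.inl fun a => le_antisymm ((ha₀ a).trans h.le) (hu a)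
      · exact Or.inr fun b => le_antisymm ((hb₀ b).trans h.le) (hv b)
    have hd : ∀ T, disjointAvg u v T = 0 := fun T => by
      rcases hz with h | h <;> simp [disjointAvg, subsetAvg, h]
    have hc : ∀ T i, crossAvg u v T i = 0 := fun T i => by
      rcases hz with h | h <;> simp [crossAvg, subsetAvg, h]
    have hB0 : 0 ≤ B := h0.trans_le (hB a₀ b₀)
    simp only [hd, hc, sum_const_zero, mul_zero, zero_add]
    positivity
  · have hU : 0 < u a₀ := pos_of_mul_pos_left hpos (hv b₀)
    have hV : 0 < v b₀ := pos_of_mul_pos_right hpos (hu a₀)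
    have key := sum_disjointAvg_le (u := fun a => (u a₀)⁻¹ * u a) (v := fun b => (v b₀)⁻¹ * v b)
      (fun a => mul_nonneg (by positivity) (hu a))
      (fun a => by rw [inv_mul_le_iff₀ hU]; simpa using ha₀ a)
      (fun a => mul_nonneg (by positivity) (hv a))
      (fun a => by rw [inv_mul_le_iff₀ hV]; simpa using hb₀ a) hε hε2 hD
    have hd : ∀ T, disjointAvg (fun a => (u a₀)⁻¹ * u a) (fun b => (v b₀)⁻¹ * v b) T =
        (u a₀ * v b₀)⁻¹ * disjointAvg u v T := fun T => by
      simp only [disjointAvg, subsetAvg_const_mul, mul_inv]; ring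
    have hc : ∀ T i, crossAvg (fun a => (u a₀)⁻¹ * u a) (fun b => (v b₀)⁻¹ * v b) T i =
        (u a₀ * v b₀)⁻¹ * crossAvg u v T i := fun T i => by
      unfold crossAvg
      rw [subsetAvg_const_mul, subsetAvg_const_mul, mul_inv]; ring
    simp only [hd, hc, ← mul_sum] at key
    have key2 := mul_le_mul_of_nonneg_left key hpos.le
    rw [mul_inv_cancel_left₀ hpos.ne'] at key2
    refine key2.trans ?_
    have hlast : 5 * (2 ^ Fintype.card ι * (Fintype.card ι * Real.exp (-D))) * (u a₀ * v b₀) ≤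
        5 * (2 ^ Fintype.card ι * (Fintype.card ι * Real.exp (-D))) * B :=
      mul_le_mul_of_nonneg_left (hB a₀ b₀) (by positivity)
    refine le_trans (le_of_eq ?_) (add_le_add_right hlast _)
    field_simp

/-- A nonnegative matrix that is close to one on disjoint pairs and smaller on pairs with one common
element has large nonnegative rank. -/
lemma le_of_eq_sum_mul {r : ℕ} {u v : Fin r → Finset ι → ℝ} (hu : ∀ k a, 0 ≤ u k a)
    (hv : ∀ k b, 0 ≤ v k b) {η B : ℝ} (hι : 0 < Fintype.card ι)
    (hlow : ∀ a b, Disjoint a b → 1 - η ≤ ∑ k, u k a * v k b)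
    (hupp : ∀ a b, Disjoint a b → ∑ k, u k a * v k b ≤ 1 + η)
    (hone : ∀ a b, #(a ∩ b) = 1 → ∑ k, u k a * v k b ≤ η)
    (hB : ∀ a b, ∑ k, u k a * v k b ≤ B) {ε D : ℝ} (hε : 0 < ε) (hε2 : ε ≤ 1 / 2) (hD : 0 ≤ D) :
    1 - η ≤ (1 + ε) / (1 - ε) ^ 2 * η + 20 * (D / Fintype.card ι) / ε ^ 2 * (1 + η) +
      10 * r * Real.exp (-D) * B := by
  set m := Fintype.card ι with hm
  have hprod : ∀ (S T : Finset ι) (f g : Fin r → Finset ι → ℝ),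
      ∑ k, subsetAvg (f k) S * subsetAvg (g k) T =
        subsetAvg (fun a => subsetAvg (fun b => ∑ k, f k a * g k b) T) S := by
    intro S T f g
    simp only [subsetAvg_sum, subsetAvg_const_mul]
    refine sum_congr rfl fun k _ => ?_
    rw [mul_comm, ← subsetAvg_const_mul]
    simp only [mul_comm]
  have hdlow : ∀ T : Finset ι, 1 - η ≤ ∑ k, disjointAvg (u k) (v k) T := fun T => by
    simp only [disjointAvg]
    rw [hprod]
    calc 1 - η = subsetAvg (fun a => subsetAvg (fun b => 1 - η) Tᶜ) T := by
          rw [subsetAvg_const, subsetAvg_const]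
      _ ≤ _ := subsetAvg_mono fun a ha => subsetAvg_mono fun b hb =>
          hlow a b (disjoint_of_subset_left ha (disjoint_of_subset_right hb disjoint_compl_right))
  have hdupp : ∀ T : Finset ι, ∑ k, disjointAvg (u k) (v k) T ≤ 1 + η := fun T => by
    simp only [disjointAvg]
    rw [hprod]
    calc _ ≤ subsetAvg (fun a => subsetAvg (fun b => 1 + η) Tᶜ) T :=
          subsetAvg_mono fun a ha => subsetAvg_mono fun b hb =>
          hupp a b (disjoint_of_subset_left ha (disjoint_of_subset_right hb disjoint_compl_right))
      _ = 1 + η := by rw [subsetAvg_const, subsetAvg_const]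
  have hcupp : ∀ T : Finset ι, ∀ i ∈ Tᶜ, ∑ k, crossAvg (u k) (v k) T i ≤ η := fun T i hi => by
    simp only [crossAvg]
    rw [hprod _ _ (fun k a => u k (insert i a)) (fun k b => v k (insert i b))]
    calc _ ≤ subsetAvg (fun a => subsetAvg (fun b => η) (Tᶜ.erase i)) T :=
          subsetAvg_mono fun a ha => subsetAvg_mono fun b hb => by
            refine hone _ _ ?_
            have hdis : a ∩ b = ∅ := disjoint_iff_inter_eq_empty.1
              (disjoint_of_subset_left ha (disjoint_of_subset_right
                (hb.trans (erase_subset _ _)) disjoint_compl_right))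
            rw [← insert_inter_distrib, hdis]
            simp
      _ = η := by rw [subsetAvg_const, subsetAvg_const]
  have hpairs : ∀ c : ℝ, ∑ T : Finset ι, ∑ _i ∈ Tᶜ, c = 2 ^ m * m / 2 * c := by
    intro c
    have h1 : ∑ T : Finset ι, ∑ _i ∈ Tᶜ, c = ∑ T : Finset ι, ∑ _i ∈ T, c :=
      sum_sum_compl_insert (fun _ _ => c)
    have h2 : ∑ T : Finset ι, ∑ _i ∈ Tᶜ, c + ∑ T : Finset ι, ∑ _i ∈ T, c = 2 ^ m * (m * c) := by
      rw [← sum_add_distrib]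
      simp only [sum_compl_add_sum]
      simp [hm]
    linarith
  have hsum := sum_le_sum fun (k : Fin r) (_ : k ∈ univ) =>
    sum_disjointAvg_le_of_mul_le (hu k) (hv k) (B := B) (fun a b =>
      (single_le_sum (f := fun k => u k a * v k b)
        (fun k _ => mul_nonneg (hu k a) (hv k b)) (mem_univ k)).trans (hB a b)) hε hε2 hD
  rw [sum_add_distrib, sum_add_distrib, ← mul_sum, ← mul_sum, sum_const, card_univ,
    Fintype.card_fin, nsmul_eq_mul, sum_comm, sum_comm (f := fun k T => disjointAvg (u k) (v k) T),
    sum_comm (f := fun k T => ∑ i ∈ Tᶜ, crossAvg (u k) (v k) T i)] at hsum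
  have e1 : 2 ^ m * m / 2 * (1 - η) ≤
      ∑ T : Finset ι, ∑ k, ∑ _i ∈ Tᶜ, disjointAvg (u k) (v k) T := by
    rw [← hpairs]
    refine sum_le_sum fun T _ => ?_
    rw [sum_comm]
    exact sum_le_sum fun i _ => hdlow T
  have e2 : ∑ T : Finset ι, ∑ k, ∑ i ∈ Tᶜ, crossAvg (u k) (v k) T i ≤ 2 ^ m * m / 2 * η := by
    rw [← hpairs]
    refine sum_le_sum fun T _ => ?_
    rw [sum_comm]
    exact sum_le_sum fun i hi => hcupp T i hi
  have e3 : ∑ T : Finset ι, ∑ k, disjointAvg (u k) (v k) T ≤ 2 ^ m * (1 + η) := by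
    calc _ ≤ ∑ _T : Finset ι, (1 + η) := sum_le_sum fun T _ => hdupp T
      _ = _ := by simp [hm, mul_add]
  have hm0 : (0 : ℝ) < m := by exact_mod_cast hι
  have hp : (0 : ℝ) < 2 ^ m * m / 2 := by positivity
  refine le_of_mul_le_mul_left ?_ hp
  refine e1.trans (hsum.trans ?_)
  have f1 := mul_le_mul_of_nonneg_left e2 (show 0 ≤ (1 + ε) / (1 - ε) ^ 2 by positivity)
  have f2 := mul_le_mul_of_nonneg_left e3 (show 0 ≤ 10 * D / ε ^ 2 by positivity)
  refine (add_le_add_left (add_le_add f1 f2) _).trans (le_of_eq ?_)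
  field_simp
  ring

end Rectangle

/-! ### Facets of the polyhedron and vertices of the correlation polytope -/

section Polytopes

variable {n : ℕ}

/-- The matrix `2 diag(a) - a aᵀ`. -/
def cliqueNormal (a : Fin n → ℝ) : Matrix (Fin n) (Fin n) ℝ :=
  (2 : ℝ) • Matrix.diagonal a - Matrix.vecMulVec a a

/-- The linear functional `⟨h, ·⟩`. -/
def traceInnerLeft (h : Matrix (Fin n) (Fin n) ℝ) : Matrix (Fin n) (Fin n) ℝ →ₗ[ℝ] ℝ where
  toFun x := traceInner h x
  map_add' x y := by simp [traceInner, mul_add]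
  map_smul' c x := by simp [traceInner]

lemma traceInner_add_smul (h x v : Matrix (Fin n) (Fin n) ℝ) (t : ℝ) :
    traceInner h (x + t • v) = traceInner h x + t * traceInner h v := by
  simp [traceInner, mul_add]

lemma traceInner_sub (h x y : Matrix (Fin n) (Fin n) ℝ) :
    traceInner h (x - y) = traceInner h x - traceInner h y := by
  simp [traceInner, mul_sub]

lemma traceInner_zero (h : Matrix (Fin n) (Fin n) ℝ) : traceInner h 0 = 0 := by
  simp [traceInner]

lemma traceInner_cliqueNormal_vecMulVec (a b : Fin n → ℝ) :
    traceInner (cliqueNormal a) (Matrix.vecMulVec b b) =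
      2 * ∑ i, a i * b i ^ 2 - (∑ i, a i * b i) ^ 2 := by
  have h1 : (Matrix.diagonal a * Matrix.vecMulVec b b).trace = ∑ i, a i * b i ^ 2 := by
    simp [Matrix.trace, Matrix.diagonal_mul, Matrix.vecMulVec_apply, sq]
  have h2 : (Matrix.vecMulVec a a * Matrix.vecMulVec b b).trace = (∑ i, a i * b i) ^ 2 := by
    rw [Matrix.vecMulVec_mul_vecMulVec, Matrix.trace_vecMulVec, dotProduct_smul, smul_eq_mul, sq,
      dotProduct]
  rw [traceInner, cliqueNormal, Matrix.transpose_sub, Matrix.transpose_smul,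
    Matrix.diagonal_transpose, Matrix.transpose_vecMulVec, sub_mul, Matrix.trace_sub,
    Matrix.smul_mul, Matrix.trace_smul, h1, h2, smul_eq_mul]

lemma traceInner_cliqueNormal_diagonal (a d : Fin n → ℝ) :
    traceInner (cliqueNormal a) (Matrix.diagonal d) = ∑ i, (2 * a i - a i ^ 2) * d i := by
  simp only [traceInner, cliqueNormal, Matrix.trace, Matrix.diag, Matrix.mul_diagonal]
  refine sum_congr rfl fun i _ => ?_
  rw [Matrix.transpose_apply, Matrix.sub_apply, Matrix.smul_apply, Matrix.diagonal_apply_eq,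
    Matrix.vecMulVec_apply, smul_eq_mul, sq]

lemma finite_zeroOneVectors (n : ℕ) : (zeroOneVectors n).Finite := by
  have : zeroOneVectors n = Set.univ.pi fun _ => ({0, 1} : Set ℝ) := by
    ext b
    simp [zeroOneVectors]
  rw [this]
  exact Set.Finite.pi fun _ => Set.toFinite _

/-- Any direction can be followed a little from a point strictly inside a family of finitely many
half-spaces. -/
lemma exists_pos_traceInner_cliqueNormal_lt {s : Set (Fin n → ℝ)} (hs : s.Finite)
    {x : Matrix (Fin n) (Fin n) ℝ} (hx : ∀ a ∈ s, traceInner (cliqueNormal a) x < 1)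
    (v : Matrix (Fin n) (Fin n) ℝ) :
    ∃ t : ℝ, 0 < t ∧ ∀ a ∈ s, traceInner (cliqueNormal a) (x + t • v) < 1 := by
  have h : ∀ᶠ t : ℝ in nhds 0, ∀ a ∈ s, traceInner (cliqueNormal a) (x + t • v) < 1 := by
    rw [Filter.eventually_all_finite hs]
    intro a ha
    simp only [traceInner_add_smul]
    have hc : ContinuousAt
        (fun t : ℝ => traceInner (cliqueNormal a) x + t * traceInner (cliqueNormal a) v) 0 := by
      fun_prop
    exact hc.eventually_lt continuousAt_const (by simpa using hx a ha)
  obtain ⟨t, ht, hpos⟩ :=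
    ((h.filter_mono nhdsWithin_le_nhds).and (self_mem_nhdsWithin (s := Set.Ioi (0 : ℝ)))).exists
  exact ⟨t, hpos, ht⟩

lemma vectorSpan_cliquePolyhedron (n : ℕ) : vectorSpan ℝ (cliquePolyhedron n) = ⊤ := by
  refine eq_top_iff.2 fun v _ => ?_
  obtain ⟨t, ht, h⟩ := exists_pos_traceInner_cliqueNormal_lt (finite_zeroOneVectors n)
    (x := 0) (fun a _ => by rw [traceInner_zero]; exact one_pos) v
  have h0 : (0 : Matrix (Fin n) (Fin n) ℝ) ∈ cliquePolyhedron n := fun a _ => by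
    rw [traceInner_zero]; exact zero_le_one
  have h1 : 0 + t • v ∈ cliquePolyhedron n := fun a ha => (h a ha).le
  have h2 := vsub_mem_vectorSpan ℝ h1 h0
  rw [vsub_eq_sub, zero_add, sub_zero] at h2
  exact (Submodule.smul_mem_iff _ ht.ne').1 h2

/-- The inequality of every nonzero `a ∈ {0,1}^n` defines a facet. The slack at
`diag(2a - 1) / |a|` of the inequality belonging to `a' ∈ {0,1}^n` is `|a' - a|² / |a|`, so at this
point the inequality of `a` is tight and all others are strict. -/
lemma isFacetNormal_cliqueNormal {a : Fin n → ℝ} (ha : a ∈ zeroOneVectors n) (ha0 : a ≠ 0) :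
    IsFacetNormal (cliquePolyhedron n) (cliqueNormal a) := by
  have hpos : 0 < ∑ i, a i := by
    obtain ⟨i, hi⟩ := Function.ne_iff.1 ha0
    refine sum_pos' (fun j _ => ?_) ⟨i, mem_univ i, ?_⟩
    · rcases ha j with h | h <;> simp [h]
    · rcases ha i with h | h
      · exact absurd h hi
      · simp [h]
  set x : Matrix (Fin n) (Fin n) ℝ :=
    Matrix.diagonal fun i => (2 * a i - 1) / ∑ j, a j with hx
  have hval : ∀ a', traceInner (cliqueNormal a') x =
      (∑ i, (2 * a' i - a' i ^ 2) * (2 * a i - 1)) / ∑ j, a j := fun a' => by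
    rw [hx, traceInner_cliqueNormal_diagonal, sum_div]
    exact sum_congr rfl fun i _ => by ring
  have htight : traceInner (cliqueNormal a) x = 1 := by
    rw [hval, div_eq_one_iff_eq hpos.ne']
    refine sum_congr rfl fun i _ => ?_
    rcases ha i with h | h <;> rw [h] <;> norm_num
  have hstrict : ∀ a' ∈ zeroOneVectors n \ {a}, traceInner (cliqueNormal a') x < 1 := by
    rintro a' ⟨ha', hne⟩
    rw [hval, div_lt_one hpos]
    obtain ⟨i, hi⟩ := Function.ne_iff.1 hne
    refine sum_lt_sum (fun j _ => ?_) ⟨i, mem_univ i, ?_⟩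
    · rcases ha j with h | h <;> rcases ha' j with h' | h' <;> rw [h, h'] <;> norm_num
    · rcases ha i with h | h <;> rcases ha' i with h' | h' <;>
        simp [h, h'] at hi ⊢
  have hface : ∀ v, traceInner (cliqueNormal a) v = 0 →
      (∀ a' ∈ zeroOneVectors n \ {a}, traceInner (cliqueNormal a') (x + v) < 1) →
      x + v ∈ {y ∈ cliquePolyhedron n | traceInner (cliqueNormal a) y = 1} := by
    intro v hv hlt
    have h1 : traceInner (cliqueNormal a) (x + v) = 1 := by
      have := traceInner_add_smul (cliqueNormal a) x v 1
      rwa [one_smul, htight, hv, mul_zero, add_zero] at this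
    refine ⟨fun a' ha' => ?_, h1⟩
    by_cases h : a' = a
    · rw [h]; exact h1.le
    · exact (hlt a' ⟨ha', h⟩).le
  have hxmem : x ∈ {y ∈ cliquePolyhedron n | traceInner (cliqueNormal a) y = 1} := by
    have := hface 0 (traceInner_zero _) (by simpa using hstrict)
    rwa [add_zero] at this
  have hspan : vectorSpan ℝ {y ∈ cliquePolyhedron n | traceInner (cliqueNormal a) y = 1} =
      LinearMap.ker (traceInnerLeft (cliqueNormal a)) := by
    refine le_antisymm (Submodule.span_le.2 ?_) fun v hv => ?_
    · rintro _ ⟨y, hy, z, hz, rfl⟩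
      change traceInner (cliqueNormal a) (y - z) = 0
      rw [traceInner_sub, hy.2, hz.2, sub_self]
    · have hv' : traceInner (cliqueNormal a) v = 0 := hv
      obtain ⟨t, ht, h⟩ := exists_pos_traceInner_cliqueNormal_lt
        ((finite_zeroOneVectors n).subset Set.sdiff_subset) hstrict v
      have htv : traceInner (cliqueNormal a) (t • v) = 0 := by
        have := traceInner_add_smul (cliqueNormal a) 0 v t
        rwa [zero_add, traceInner_zero, hv', mul_zero, add_zero] at this
      have h2 := vsub_mem_vectorSpan ℝ (hface (t • v) htv h) hxmem
      rw [vsub_eq_sub, add_sub_cancel_left] at h2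
      exact (Submodule.smul_mem_iff _ ht.ne').1 h2
  refine ⟨fun y hy => hy a ha, ⟨x, hxmem⟩, ?_⟩
  rw [hspan, vectorSpan_cliquePolyhedron, finrank_top]
  refine Module.Dual.finrank_ker_add_one_of_ne_zero (f := traceInnerLeft (cliqueNormal a)) ?_
  intro h0
  have : traceInner (cliqueNormal a) x = 0 := LinearMap.congr_fun h0 x
  rw [htight] at this
  exact one_ne_zero this

lemma entry_mem_Icc_of_mem_correlationPolytope {x : Matrix (Fin n) (Fin n) ℝ}
    (hx : x ∈ correlationPolytope n) (i j : Fin n) : x i j ∈ Set.Icc (0 : ℝ) 1 := by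
  have hconv : Convex ℝ {y : Matrix (Fin n) (Fin n) ℝ | y i j ∈ Set.Icc (0 : ℝ) 1} :=
    (convex_Icc (0 : ℝ) 1).is_linear_preimage
      (f := fun y : Matrix (Fin n) (Fin n) ℝ => y i j) ⟨fun _ _ => rfl, fun _ _ => rfl⟩
  refine convexHull_min ?_ hconv hx
  rintro _ ⟨b, hb, rfl⟩
  rcases hb i with h | h <;> rcases hb j with h' | h' <;> simp [Matrix.vecMulVec_apply, h, h']

lemma vecMulVec_mem_extremePoints {b : Fin n → ℝ} (hb : b ∈ zeroOneVectors n) :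
    Matrix.vecMulVec b b ∈ (correlationPolytope n).extremePoints ℝ := by
  rw [mem_extremePoints_iff_left]
  refine ⟨subset_convexHull ℝ _ ⟨b, hb, rfl⟩, ?_⟩
  rintro y hy z hz ⟨s, t, hs, ht, hst, h⟩
  ext i j
  obtain ⟨y0, y1⟩ := entry_mem_Icc_of_mem_correlationPolytope hy i j
  obtain ⟨z0, z1⟩ := entry_mem_Icc_of_mem_correlationPolytope hz i j
  have hij : s * y i j + t * z i j = Matrix.vecMulVec b b i j := by
    rw [← h]; simp
  have hb' : Matrix.vecMulVec b b i j = 0 ∨ Matrix.vecMulVec b b i j = 1 := by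
    rcases hb i with h | h <;> rcases hb j with h' | h' <;> simp [Matrix.vecMulVec_apply, h, h']
  rcases hb' with h0 | h0 <;> rw [h0] at hij ⊢ <;> nlinarith

/-- The `{0,1}`-vector with support `s`. -/
def supportVector (s : Finset (Fin n)) : Fin n → ℝ :=
  fun i => if i ∈ s then 1 else 0

lemma supportVector_mem (s : Finset (Fin n)) : supportVector s ∈ zeroOneVectors n := fun i => by
  by_cases h : i ∈ s <;> simp [supportVector, h]

lemma one_sub_traceInner_supportVector (s t : Finset (Fin n)) :
    1 - traceInner (cliqueNormal (supportVector s))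
      (Matrix.vecMulVec (supportVector t) (supportVector t)) = (1 - (#(s ∩ t) : ℝ)) ^ 2 := by
  have h1 : ∑ i, supportVector s i * supportVector t i = #(s ∩ t) := by
    simp [supportVector, ← ite_and, ← mem_inter, inter_comm]
  have h2 : ∑ i, supportVector s i * supportVector t i ^ 2 = #(s ∩ t) := by
    rw [← h1]
    refine sum_congr rfl fun i _ => ?_
    by_cases h : i ∈ t <;> simp [supportVector, h]
  rw [traceInner_cliqueNormal_vecMulVec, h1, h2]
  ring

/-- The slack matrix of `COR(m + 1)` contains the matrix `(1 - |s ∩ t|)²` indexed by all subsets of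
`Fin m`. The extra coordinate lies in the first support only: it makes the first vector nonzero and
leaves the intersection unchanged. -/
lemma exists_slackMatrix_eq (m : ℕ) :
    ∃ (f : Finset (Fin m) → {h : Matrix (Fin (m + 1)) (Fin (m + 1)) ℝ //
          IsFacetNormal (cliquePolyhedron (m + 1)) h})
      (g : Finset (Fin m) → (correlationPolytope (m + 1)).extremePoints ℝ),
      ∀ s t, slackMatrix (correlationPolytope (m + 1)) (cliquePolyhedron (m + 1)) (f s) (g t) =
        (1 - (#(s ∩ t) : ℝ)) ^ 2 := by
  refine ⟨fun s => ⟨cliqueNormal (supportVector (insert 0 (s.map (Fin.succEmb m)))),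
    isFacetNormal_cliqueNormal (supportVector_mem _) fun h => ?_⟩,
    fun t => ⟨_, vecMulVec_mem_extremePoints (supportVector_mem (t.map (Fin.succEmb m)))⟩,
    fun s t => ?_⟩
  · have := congrFun h 0
    simp [supportVector] at this
  · have hinter : insert 0 (s.map (Fin.succEmb m)) ∩ t.map (Fin.succEmb m) =
        (s ∩ t).map (Fin.succEmb m) := by
      rw [insert_inter_of_notMem (by simp [Fin.succ_ne_zero]), map_inter]
    unfold slackMatrix
    rw [one_sub_traceInner_supportVector, hinter, card_map]

end Polytopes

/-! ### The exponential bound -/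

lemma le_nonnegRank {α β : Type*} {S : Matrix α β ℝ} {x : ℝ}
    (h : ∀ r : ℕ, HasNonnegFactorization S r → x ≤ r) : ((⌈x⌉₊ : ℕ) : ℕ∞) ≤ nonnegRank S :=
  le_iInf₂ fun r hr => by exact_mod_cast Nat.ceil_le.2 (h r hr)

/-- The rank bound for a matrix indexed by pairs of subsets of `Fin m` that is `η`-close to
`(1 - |s ∩ t|)²`. -/
lemma exp_le_mul_of_abs_sub_le {η : ℝ} (hη0 : 0 < η) (hη : η < 1 / 2) :
    ∃ δ g : ℝ, 0 < δ ∧ 0 < g ∧ ∀ (m r : ℕ) (u v : Fin r → Finset (Fin m) → ℝ),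
      0 < m → (∀ k s, 0 ≤ u k s) → (∀ k t, 0 ≤ v k t) →
      (∀ s t, |(1 - (#(s ∩ t) : ℝ)) ^ 2 - ∑ k, u k s * v k t| ≤ η) →
      g * Real.exp (δ * m) ≤ r * ((m : ℝ) ^ 2 + 2) := by
  -- small enough for `(1 + ε) / (1 - ε)² < (1 - η) / η`
  set ε := (1 - 2 * η) / 8 with hε
  have hε0 : 0 < ε := by linarith
  have hε1 : ε < 1 / 8 := by linarith
  have hC : (1 + ε) / (1 - ε) ^ 2 * η < 1 - η := by
    have h1 : 0 < 1 - ε := by linarith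
    rw [div_mul_eq_mul_div, div_lt_iff₀ (by positivity)]
    have h2 : η = (1 - 8 * ε) / 2 := by linarith
    rw [h2]
    nlinarith [mul_pos hε0 hε0, mul_pos hε0 (sub_pos.2 hε1), mul_pos (mul_pos hε0 hε0) hε0]
  set G := 1 - η - (1 + ε) / (1 - ε) ^ 2 * η with hG
  have hG0 : 0 < G := by linarith
  refine ⟨G * ε ^ 2 / (40 * (1 + η)), G / 20, by positivity, by positivity, ?_⟩
  intro m r u v hm hu hv habs
  set δ := G * ε ^ 2 / (40 * (1 + η)) with hδ
  have hδ0 : 0 < δ := by positivity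
  have hmR : (0 : ℝ) < m := by exact_mod_cast hm
  have key := le_of_eq_sum_mul (ι := Fin m) hu hv (η := η) (B := (m : ℝ) ^ 2 + 2) (ε := ε)
    (D := δ * m) (by simpa using hm)
    (fun a b hab => by
      have := habs a b
      rw [disjoint_iff_inter_eq_empty.1 hab] at this
      have := abs_le.1 this
      norm_num at this
      linarith)
    (fun a b hab => by
      have := habs a b
      rw [disjoint_iff_inter_eq_empty.1 hab] at this
      have := abs_le.1 this
      norm_num at this
      linarith)
    (fun a b hab => by
      have := habs a b
      rw [hab] at this
      have := abs_le.1 this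
      norm_num at this
      linarith)
    (fun a b => by
      have h1 := abs_le.1 (habs a b)
      have h2 : (#(a ∩ b) : ℝ) ≤ m := by
        exact_mod_cast (card_le_univ (a ∩ b)).trans_eq (Fintype.card_fin m)
      have h3 : (0 : ℝ) ≤ #(a ∩ b) := by positivity
      nlinarith)
    hε0 (by linarith) (by positivity)
  rw [Fintype.card_fin, mul_div_cancel_right₀ _ hmR.ne'] at key
  have h1 : 20 * δ / ε ^ 2 * (1 + η) = G / 2 := by
    rw [hδ]
    field_simp
    norm_num
  rw [h1] at key
  have h2 : G / 20 ≤ r * ((m : ℝ) ^ 2 + 2) * Real.exp (-(δ * m)) := by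
    have : G / 2 ≤ 10 * r * Real.exp (-(δ * m)) * ((m : ℝ) ^ 2 + 2) := by linarith
    linarith
  rw [Real.exp_neg, ← div_eq_mul_inv, le_div_iff₀ (Real.exp_pos _)] at h2
  exact h2

lemma eventually_sq_add_two_mul_exp_le {δ g : ℝ} (hδ : 0 < δ) (hg : 0 < g) :
    ∀ᶠ n : ℕ in Filter.atTop,
      ((n : ℝ) ^ 2 + 2) * Real.exp (δ / 2 * n) ≤ g * Real.exp (δ * n) := by
  have h := ((isLittleO_pow_exp_pos_mul_atTop 2 (half_pos hδ)).comp_tendsto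
    (tendsto_natCast_atTop_atTop (R := ℝ))).bound (half_pos hg)
  filter_upwards [h, Filter.eventually_ge_atTop 2] with n hn h2
  simp only [Function.comp_apply, norm_pow, Real.norm_eq_abs, Real.abs_exp, sq_abs] at hn
  have h2' : (2 : ℝ) ≤ n := by exact_mod_cast h2
  have h3 : (n : ℝ) ^ 2 + 2 ≤ g * Real.exp (δ / 2 * n) := by nlinarith
  calc _ ≤ g * Real.exp (δ / 2 * n) * Real.exp (δ / 2 * n) := by gcongr
    _ = g * Real.exp (δ * n) := by rw [mul_assoc, ← Real.exp_add]; ring_nf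

end CorrelationSlack

theorem proposition4p5 (η : ℝ) (hη0 : 0 < η) (hη : η < 1 / 2) :
    ∃ c : ℝ, 0 < c ∧ ∃ N : ℕ, ∀ n : ℕ, N ≤ n →
      ∀ S' : Matrix
          {h : Matrix (Fin n) (Fin n) ℝ //
            CorrelationSlack.IsFacetNormal (CorrelationSlack.cliquePolyhedron n) h}
          ((CorrelationSlack.correlationPolytope n).extremePoints ℝ) ℝ,
        (∀ i j, 0 ≤ S' i j) →
        (∀ i j,
          |CorrelationSlack.slackMatrix (CorrelationSlack.correlationPolytope n)
              (CorrelationSlack.cliquePolyhedron n) i j - S' i j| ≤ η) →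
        ((⌈(2 : ℝ) ^ (c * (n : ℝ))⌉₊ : ℕ) : ℕ∞) ≤ CorrelationSlack.nonnegRank S' := by
  obtain ⟨δ, g, hδ, hg, hmain⟩ := CorrelationSlack.exp_le_mul_of_abs_sub_le hη0 hη
  obtain ⟨N, hN⟩ := Filter.eventually_atTop.1
    (CorrelationSlack.eventually_sq_add_two_mul_exp_le hδ (mul_pos hg (Real.exp_pos (-δ))))
  refine ⟨δ / 2, half_pos hδ, max N 2, fun n hn S' _ hS' => ?_⟩
  refine CorrelationSlack.le_nonnegRank fun r ⟨A, B, hA, hB, hAB⟩ => ?_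
  obtain ⟨m, rfl⟩ : ∃ m, n = m + 1 := ⟨n - 1, by omega⟩
  obtain ⟨f, f', hff'⟩ := CorrelationSlack.exists_slackMatrix_eq m
  have h1 := hmain m r (fun k s => A k (f s)) (fun k t => B k (f' t)) (by omega)
    (fun k s => hA k _) (fun k t => hB k _) fun s t => by
      have := hS' (f s) (f' t)
      rwa [hff', hAB, Matrix.mul_apply] at this
  have h2 := hN (m + 1) (by omega)
  set n : ℝ := ((m + 1 : ℕ) : ℝ) with hn
  have hnm : n = m + 1 := by rw [hn]; push_cast; rfl
  have h3 : (n ^ 2 + 2) * Real.exp (δ / 2 * n) ≤ r * (n ^ 2 + 2) :=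
    calc _ ≤ g * Real.exp (-δ) * Real.exp (δ * n) := h2
      _ = g * Real.exp (δ * m) := by rw [mul_assoc, ← Real.exp_add, hnm]; ring_nf
      _ ≤ r * ((m : ℝ) ^ 2 + 2) := h1
      _ ≤ r * (n ^ 2 + 2) := by gcongr; linarith
  have h4 : Real.exp (δ / 2 * n) ≤ r := by
    have : 0 < n ^ 2 + 2 := by positivity
    nlinarith
  refine le_trans ?_ h4
  rw [Real.rpow_def_of_pos two_pos]
  refine Real.exp_le_exp.2 (mul_le_of_le_one_left (by positivity) ?_)
  exact Real.log_two_lt_d9.le.trans (by norm_num)
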